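/- Fix an integer $d \ge 1$. Let $X^{(1)}, X^{(2)}, \dots$ be independent random vectors in $\mathbb{R}^d$, each having independent coordinates that are uniformly distributed over $[0,1)$. For $n \ge 0$ let $$S_n := \{x \in [0,1)^d : \text{there is no } i \in \{1,\dots,n\} \text{ such that } x_j < X^{(i)}_j \text{ for every } j = 1,\dots,d\}$$ be the record-setting region at time $n$. The minimal elements of $S_n$ with respect to the coordinatewise partial order $\le$ are called the generators at time $n$; a generator is called interior if all of its coordinates are nonzero. Let $\mathcal{I}_{d,n}$ denote the expected number of interior generators at time $n$. Then $\mathcal{I}_{d,n}$ is finite and, as $n \to \infty$ with $d$ fixed, $$\mathcal{I}_{d,n} = (\ln n)^{d-1} \sum_{j=0}^{d-1} \frac{(-1)^j\, \Gamma^{(j)}(d)}{j!\,(d-1-j)!}\, (\ln n)^{-j} + O\bigl(n^{-1} (\ln n)^{d-1}\bigr),$$ where $\Gamma^{(j)}$ is the $j$th derivative of the gamma function. -/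

import Mathlib

open MeasureTheory ProbabilityTheory

namespace ParetoRecords

/-- The half-open unit hypercube `[0, 1)^d`. -/
def unitCube (d : ℕ) : Set (Fin d → ℝ) :=
  {x | ∀ j, x j ∈ Set.Ico (0 : ℝ) 1}

/-- The record-setting region at time `n` of a sequence `x 0, x 1, …` of points: the points of
`[0, 1)^d` that are not strictly smaller, in every coordinate simultaneously, than one of the
first `n` points of the sequence. (`StrongLT a b` means `∀ j, a j < b j`.) -/
def recordSettingRegion {d : ℕ} (x : ℕ → Fin d → ℝ) (n : ℕ) : Set (Fin d → ℝ) :=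
  {y | y ∈ unitCube d ∧ ∀ i < n, ¬ StrongLT y (x i)}

/-- The generators at time `n`: the minimal elements of the record-setting region for the
coordinatewise partial order. -/
def generators {d : ℕ} (x : ℕ → Fin d → ℝ) (n : ℕ) : Set (Fin d → ℝ) :=
  {g | Minimal (fun y => y ∈ recordSettingRegion x n) g}

/-- The interior generators at time `n`: the generators with no vanishing coordinate. -/
def interiorGenerators {d : ℕ} (x : ℕ → Fin d → ℝ) (n : ℕ) : Set (Fin d → ℝ) :=
  {g | g ∈ generators x n ∧ ∀ j, g j ≠ 0}

/-- `X 0, X 1, …` are independent random vectors in dimension `d`, each of which has independent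
coordinates that are uniformly distributed over `[0, 1)`. -/
structure IsUniformObservations {d : ℕ} {Ω : Type*} [MeasurableSpace Ω] (P : Measure Ω)
    (X : ℕ → Ω → Fin d → ℝ) : Prop where
  measurable : ∀ i, Measurable (X i)
  indep_observations : iIndepFun X P
  indep_coordinates : ∀ i, iIndepFun (fun (j : Fin d) (ω : Ω) => X i ω j) P
  uniform : ∀ i j, pdf.IsUniform (fun ω => X i ω j) (Set.Ico (0 : ℝ) 1) P volume

/-- The number of interior generators after the first `n` observations, as a random variable. -/
noncomputable def numInteriorGenerators {d : ℕ} {Ω : Type*} (X : ℕ → Ω → Fin d → ℝ) (n : ℕ)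
    (ω : Ω) : ℕ :=
  (interiorGenerators (fun i => X i ω) n).ncard

end ParetoRecords

/-!
In general position, an interior generator `g` is determined by an embedding `σ` of the coordinates
into the observations: coordinate `k` of `g` is coordinate `k` of observation `σ k`, this
observation exceeds `g` in all other coordinates, and no observation exceeds `g` in all coordinates
(`interiorGenerators_eq_image`). Hence the expected number of interior generators is the number
`n (n - 1) ⋯ (n - d + 1)` of embeddings times the probability that a fixed embedding qualifies.

For a fixed `σ`, the condition on observation `σ j` ignores the coordinate `j` that enters `g`, so
`g` can be replaced by an independent uniform point (`measurePreserving_resample`). Given `g`, with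
`p = ∏ k, (1 - g k)` the volume of the box above `g`, the conditions on the observations are
independent and have probability `p ^ (d - 1) * (1 - p) ^ (n - d)` together. Since `p` is a product
of `d` independent uniform variables, it has density `(-log p) ^ (d - 1) / (d - 1)!`
(`lintegral_prod_one_sub`), which turns the expectation into the one-dimensional integral
`expectedCount`.

Substituting `p = t / n` turns this integral into that of
`t ^ (d - 1) (1 - t / n) ^ (n - d) (log n - log t) ^ (d - 1)` over `t < n`. Replacing
`(1 - t / n) ^ (n - d)` by `e⁻ᵗ` changes the integrand by `O(1 / n)` relative to an integrable
weight (`abs_one_sub_div_pow_sub_exp_le`), and expanding `(log n - log t) ^ (d - 1)` produces the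
integrals of `t ^ (d - 1) (log t) ^ j e⁻ᵗ`. These are the derivatives of the gamma function at `d`,
because `Γ (v + 1)` is the moment generating function of `log` under `e⁻ᵗ dt`
(`iteratedDeriv_Gamma_natCast_add_one`).
-/

namespace ParetoRecords

/-! ### Interior generators and embeddings -/

/-- The combinatorial data of an interior generator: the `k`th coordinate of the generator is the
`k`th coordinate of observation `σ k`, that observation exceeds the generator in every other
coordinate, and the generator lies in the record-setting region of the first `n` observations. -/
def IsGeneratorIndex {d n : ℕ} (x : ℕ → Fin d → ℝ) (σ : Fin d ↪ Fin n) : Prop :=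
  (∀ j k, k ≠ j → x (σ k) k < x (σ j) k) ∧ ∀ i : Fin n, ∃ k, x i k ≤ x (σ k) k

/-- Observations in general position: points of the open unit cube such that no two of them share
the value of a coordinate. -/
def InGeneralPosition {d : ℕ} (x : ℕ → Fin d → ℝ) (n : ℕ) : Prop :=
  (∀ i < n, ∀ k, x i k ∈ Set.Ioo (0 : ℝ) 1) ∧
    ∀ i < n, ∀ i' < n, ∀ k, x i k = x i' k → i = i'

/-- Lowering coordinate `j` of an interior generator always leaves the record-setting region. There
being finitely many observations, one of them is responsible for all small decreases, and so agrees
with the generator in coordinate `j`. -/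
lemma exists_observation_of_mem_interiorGenerators {d n : ℕ} {x : ℕ → Fin d → ℝ} {g : Fin d → ℝ}
    (hg : g ∈ interiorGenerators x n) (j : Fin d) :
    ∃ i < n, x i j = g j ∧ ∀ k, k ≠ j → g k < x i k := by
  obtain ⟨⟨⟨hcube, hrec⟩, hmin⟩, hne⟩ := hg
  have hpos : 0 < g j := lt_of_le_of_ne (hcube j).1 (hne j).symm
  have key : ∀ y, 0 ≤ y → y < g j → ∃ i < n, y < x i j ∧ ∀ k, k ≠ j → g k < x i k := by
    intro y hy hyg
    by_contra! hcon
    have hle : Function.update g j y ≤ g := by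
      intro k
      by_cases hk : k = j
      · subst hk; simpa using hyg.le
      · simp [hk]
    have hmem : Function.update g j y ∈ recordSettingRegion x n := by
      refine ⟨fun k => ?_, fun i hi hs => ?_⟩
      · by_cases hk : k = j
        · subst hk; simpa using ⟨hy, hyg.trans (hcube k).2⟩
        · simpa [hk] using hcube k
      · have h1 : y < x i j := by simpa using hs j
        obtain ⟨k, hk, hkx⟩ := hcon i hi h1
        have := hs k
        simp only [Function.update_of_ne hk] at this
        exact absurd this (not_lt.mpr hkx)
    have := hmin hmem hle j
    simp only [Function.update_self] at this
    exact absurd this (not_le.mpr hyg)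
  -- If no observation works, all those that exceed `g` off coordinate `j` stay below `g j` in
  -- coordinate `j`, and a value `y < g j` above all of them contradicts `key`.
  by_contra! hcon
  have hlt : ∀ i < n, (∀ k, k ≠ j → g k < x i k) → x i j < g j := by
    intro i hi hk
    refine lt_of_le_of_ne (not_lt.mp fun h => hrec i hi fun k => ?_) fun h => ?_
    · by_cases hkj : k = j
      · subst hkj; exact h
      · exact hk k hkj
    · obtain ⟨k, hkj, hle⟩ := hcon i hi h
      exact absurd (hk k hkj) (not_lt.mpr hle)
  classical
  let s : Finset ℕ := (Finset.range n).filter fun i => ∀ k, k ≠ j → g k < x i k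
  obtain ⟨y, hy0, hyg, hys⟩ : ∃ y, 0 ≤ y ∧ y < g j ∧ ∀ i ∈ s, x i j ≤ y := by
    let t : Finset ℝ := insert 0 (s.image fun i => x i j)
    have ht : t.Nonempty := ⟨0, by simp [t]⟩
    refine ⟨t.max' ht, t.le_max' _ (by simp [t]), ?_, fun i hi => t.le_max' _ ?_⟩
    · rw [Finset.max'_lt_iff]
      intro z hz
      rcases Finset.mem_insert.mp hz with rfl | hz
      · exact hpos
      · obtain ⟨i, hi, rfl⟩ := Finset.mem_image.mp hz
        obtain ⟨h1, h2⟩ := Finset.mem_filter.mp hi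
        exact hlt i (Finset.mem_range.mp h1) h2
    · exact Finset.mem_insert_of_mem (Finset.mem_image_of_mem _ hi)
  obtain ⟨i, hi, h1, h2⟩ := key y hy0 hyg
  exact absurd (hys i (Finset.mem_filter.mpr ⟨Finset.mem_range.mpr hi, h2⟩)) (not_le.mpr h1)

/-- Interior generators are exactly the points read off from the generator indices. -/
lemma interiorGenerators_eq_image {d n : ℕ} {x : ℕ → Fin d → ℝ}
    (hx : InGeneralPosition x n) :
    interiorGenerators x n =
      (fun (σ : Fin d ↪ Fin n) k => x (σ k) k) '' {σ | IsGeneratorIndex x σ} := by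
  ext g
  constructor
  · intro hg
    choose i hin hij hik using exists_observation_of_mem_interiorGenerators hg
    have hinj : Function.Injective i := by
      intro j k hjk
      by_contra hne
      have h1 := hik j k (Ne.symm hne)
      rw [hjk, hij k] at h1
      exact lt_irrefl _ h1
    refine ⟨⟨fun k => ⟨i k, hin k⟩, fun j k h => hinj (Fin.mk.inj_iff.mp h)⟩, ⟨?_, ?_⟩, ?_⟩
    · intro j k hkj
      exact (hij k).le.trans_lt (hik j k hkj)
    · intro m
      obtain ⟨k, hk⟩ := not_forall.mp (hg.1.1.2 m m.2)
      exact ⟨k, (not_lt.mp hk).trans (hij k).ge⟩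
    · funext k
      exact hij k
  · rintro ⟨σ, ⟨h1, h2⟩, rfl⟩
    refine ⟨⟨⟨fun k => Set.Ioo_subset_Ico_self (hx.1 _ (σ k).2 k), fun i hi hs => ?_⟩, ?_⟩,
      fun k => (hx.1 _ (σ k).2 k).1.ne'⟩
    · obtain ⟨k, hk⟩ := h2 ⟨i, hi⟩
      exact absurd (hs k) (not_lt.mpr hk)
    · intro y hy hle j
      by_contra! hlt
      refine hy.2 (σ j) (σ j).2 fun k => ?_
      by_cases hkj : k = j
      · subst hkj; exact hlt
      · exact (hle k).trans_lt (h1 j k hkj)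

open Classical in
lemma ncard_interiorGenerators {d n : ℕ} {x : ℕ → Fin d → ℝ}
    (hx : InGeneralPosition x n) :
    (interiorGenerators x n).ncard =
      ∑ σ : Fin d ↪ Fin n, if IsGeneratorIndex x σ then 1 else 0 := by
  rw [interiorGenerators_eq_image hx, Set.ncard_image_of_injective]
  · rw [Finset.sum_boole, Nat.cast_id, ← Set.ncard_coe_finset]
    simp
  · intro σ τ h
    ext k
    exact hx.2 _ (σ k).2 _ (τ k).2 k (congrFun h k)

/-! ### Resampling entries of an array -/

/-- The condition that `IsGeneratorIndex` puts on observation `i` when the position `g` of the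
generator is prescribed independently of the observations: observation `σ j` has to exceed `g` off
coordinate `j`, and an observation outside the range of `σ` must not exceed `g` everywhere. -/
def rowEvent {d n : ℕ} (σ : Fin d ↪ Fin n) (g : Fin d → ℝ) (i : Fin n) : Set (Fin d → ℝ) :=
  {r | (∀ j, σ j = i → ∀ k, k ≠ j → g k < r k) ∧ (i ∉ Set.range σ → ∃ k, r k ≤ g k)}

/-- In an array of independent entries, overwriting for each column `k` the entry in row `σ k` by
an independent copy does not change the law of the array. -/
theorem measurePreserving_resample {α ι κ : Type*} [MeasurableSpace α] [Fintype ι] [Fintype κ]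
    [DecidableEq ι] (ν : Measure α) [IsProbabilityMeasure ν] (σ : κ → ι) :
    MeasurePreserving
      (fun (p : (κ → α) × (ι → κ → α)) (i : ι) (k : κ) => if σ k = i then p.1 k else p.2 i k)
      ((Measure.pi fun _ => ν).prod (Measure.pi fun _ => Measure.pi fun _ => ν))
      (Measure.pi fun _ => Measure.pi fun _ => ν) := by
  have hmeas : Measurable
      (fun (p : (κ → α) × (ι → κ → α)) (i : ι) (k : κ) => if σ k = i then p.1 k else p.2 i k) := by
    refine measurable_pi_lambda _ fun i => measurable_pi_lambda _ fun k => ?_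
    split_ifs <;> fun_prop
  refine ⟨hmeas, Eq.symm ?_⟩
  refine Measure.pi_eq_generateFrom (fun _ => generateFrom_pi) (fun _ => isPiSystem_pi)
    (fun _ => ⟨fun _ => Set.univ, fun _ => ⟨fun _ => Set.univ, by simp, by simp⟩, by simp,
      Set.iUnion_const _⟩) fun s hs => ?_
  choose t ht hts using hs
  obtain rfl : (fun i => Set.pi Set.univ (t i)) = s := funext hts
  have htm : ∀ i k, MeasurableSet (t i k) := fun i k => ht i k (Set.mem_univ k)
  rw [Measure.map_apply hmeas
    (MeasurableSet.univ_pi fun i => MeasurableSet.univ_pi fun k => htm i k)]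
  have hpre : (fun (p : (κ → α) × (ι → κ → α)) (i : ι) (k : κ) =>
      if σ k = i then p.1 k else p.2 i k) ⁻¹' (Set.pi Set.univ fun i => Set.pi Set.univ (t i)) =
      (Set.pi Set.univ fun k => t (σ k) k) ×ˢ
        (Set.pi Set.univ fun i => Set.pi Set.univ fun k =>
          if σ k = i then Set.univ else t i k) := by
    ext p
    simp only [Set.mem_preimage, Set.mem_pi, Set.mem_univ, true_implies, Set.mem_prod]
    constructor
    · intro h
      refine ⟨fun k => by simpa using h (σ k) k, fun i k => ?_⟩
      have := h i k
      split_ifs at this ⊢ <;> simp_all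
    · rintro ⟨h1, h2⟩ i k
      have := h2 i k
      split_ifs at this ⊢ with h
      · exact h ▸ h1 k
      · exact this
  rw [hpre, Measure.prod_prod]
  simp only [Measure.pi_pi]
  rw [Finset.prod_comm, Finset.prod_comm (f := fun i k => ν (t i k)), ← Finset.prod_mul_distrib]
  refine Finset.prod_congr rfl fun k _ => ?_
  rw [← Finset.mul_prod_erase _ _ (Finset.mem_univ (σ k)),
    ← Finset.mul_prod_erase _ (fun i => ν (t i k)) (Finset.mem_univ (σ k))]
  simp only [if_true, measure_univ, one_mul]
  congr 1
  refine Finset.prod_congr rfl fun i hi => ?_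
  rw [if_neg (Finset.ne_of_mem_erase hi).symm]

/-- Since `σ` is injective, the row event of row `σ j` does not look at coordinate `j`, so the
entries read off as the generator can be resampled freely. -/
lemma generatorIndex_resample_iff {d n : ℕ} (σ : Fin d ↪ Fin n) (g : Fin d → ℝ)
    (u : Fin n → Fin d → ℝ) :
    ((∀ j k, k ≠ j → g k < if σ k = σ j then g k else u (σ j) k) ∧
      ∀ i : Fin n, ∃ k, (if σ k = i then g k else u i k) ≤ g k) ↔
      u ∈ Set.pi Set.univ (rowEvent σ g) := by
  simp only [rowEvent, Set.mem_pi, Set.mem_univ, true_implies, Set.mem_ofPred_eq]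
  constructor
  · rintro ⟨h1, h2⟩ i
    refine ⟨?_, fun hi => ?_⟩
    · rintro j rfl k hk
      simpa [hk] using h1 j k hk
    · obtain ⟨k, hk⟩ := h2 i
      rw [if_neg fun h => hi ⟨k, h⟩] at hk
      exact ⟨k, hk⟩
  · intro h
    refine ⟨fun j k hk => ?_, fun i => ?_⟩
    · simpa [hk] using (h (σ j)).1 j rfl k hk
    · by_cases hi : i ∈ Set.range σ
      · obtain ⟨k, rfl⟩ := hi
        exact ⟨k, by simp⟩
      · obtain ⟨k, hk⟩ := (h i).2 hi
        refine ⟨k, ?_⟩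
        rwa [if_neg fun h => hi ⟨k, h⟩]

/-! ### The probability of a generator index -/

/-- The uniform distribution on `[0, 1)`. -/
noncomputable abbrev unif : Measure ℝ := volume.restrict (Set.Ico 0 1)

instance : IsProbabilityMeasure unif := ⟨by simp⟩

lemma unif_Ioi {a : ℝ} (ha : a ∈ Set.Ico (0 : ℝ) 1) :
    unif (Set.Ioi a) = ENNReal.ofReal (1 - a) := by
  have : Set.Ioi a ∩ Set.Ico 0 1 = Set.Ioo a 1 := by
    ext x
    exact ⟨fun h => ⟨h.1, h.2.2⟩, fun h => ⟨h.1, ha.1.trans h.1.le, h.2⟩⟩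
  rw [Measure.restrict_apply measurableSet_Ioi, this, Real.volume_Ioo]

lemma measure_rowEvent_of_mem_range {d n : ℕ} (σ : Fin d ↪ Fin n) {g : Fin d → ℝ}
    (hg : g ∈ unitCube d) (j : Fin d) :
    (Measure.pi fun _ => unif) (rowEvent σ g (σ j)) =
      ENNReal.ofReal (∏ k ∈ Finset.univ.erase j, (1 - g k)) := by
  have : rowEvent σ g (σ j) =
      Set.pi Set.univ fun k => if k = j then Set.univ else Set.Ioi (g k) := by
    ext r
    simp only [rowEvent, Set.mem_ofPred_eq, EmbeddingLike.apply_eq_iff_eq, forall_eq, Set.mem_range,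
      exists_eq, not_true_eq_false, false_implies, and_true, Set.mem_pi, Set.mem_univ, true_implies]
    refine forall_congr' fun k => ?_
    by_cases hk : k = j <;> simp [hk]
  rw [this, Measure.pi_pi, ← Finset.mul_prod_erase _ _ (Finset.mem_univ j),
    ENNReal.ofReal_prod_of_nonneg fun k _ => sub_nonneg.mpr (hg k).2.le]
  simp only [if_true, measure_univ, one_mul]
  refine Finset.prod_congr rfl fun k hk => ?_
  rw [if_neg (Finset.ne_of_mem_erase hk), unif_Ioi (hg k)]

lemma measure_rowEvent_of_notMem_range {d n : ℕ} (σ : Fin d ↪ Fin n) {g : Fin d → ℝ}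
    (hg : g ∈ unitCube d) {i : Fin n} (hi : i ∉ Set.range σ) :
    (Measure.pi fun _ => unif) (rowEvent σ g i) = ENNReal.ofReal (1 - ∏ k, (1 - g k)) := by
  have : rowEvent σ g i = (Set.pi Set.univ fun k => Set.Ioi (g k))ᶜ := by
    ext r
    have h : ∀ j, σ j ≠ i := fun j h => hi ⟨j, h⟩
    simp [rowEvent, h]
  have h0 : ∀ k ∈ (Finset.univ : Finset (Fin d)), 0 ≤ 1 - g k :=
    fun k _ => sub_nonneg.mpr (hg k).2.le
  rw [this, prob_compl_eq_one_sub (MeasurableSet.univ_pi fun _ => measurableSet_Ioi), Measure.pi_pi,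
    Finset.prod_congr rfl fun k _ => unif_Ioi (hg k), ← ENNReal.ofReal_prod_of_nonneg h0,
    ENNReal.ofReal_sub _ (Finset.prod_nonneg h0), ENNReal.ofReal_one]

lemma measure_pi_rowEvent {d n : ℕ} (σ : Fin d ↪ Fin n) {g : Fin d → ℝ} (hg : g ∈ unitCube d) :
    (Measure.pi fun _ => Measure.pi fun _ => unif) (Set.pi Set.univ (rowEvent σ g)) =
      ENNReal.ofReal ((∏ k, (1 - g k)) ^ (d - 1) * (1 - ∏ k, (1 - g k)) ^ (n - d)) := by
  classical
  have h0 : ∀ k, 0 ≤ 1 - g k := fun k => sub_nonneg.mpr (hg k).2.le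
  have h1 : 0 ≤ 1 - ∏ k, (1 - g k) :=
    sub_nonneg.mpr (Finset.prod_le_one (fun k _ => h0 k) fun k _ => by linarith [(hg k).1])
  rw [Measure.pi_pi, ← Finset.prod_mul_prod_compl (Finset.univ.map σ), Finset.prod_map,
    Finset.prod_congr rfl fun j _ => measure_rowEvent_of_mem_range σ hg j,
    Finset.prod_congr (s₁ := (Finset.univ.map σ)ᶜ) rfl fun i hi =>
      measure_rowEvent_of_notMem_range σ hg (by simpa using hi),
    Finset.prod_const, Finset.card_compl, Finset.card_map, Finset.card_univ, Fintype.card_fin,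
    Fintype.card_fin, ← ENNReal.ofReal_prod_of_nonneg
      fun j _ => Finset.prod_nonneg fun k _ => h0 k,
    ← ENNReal.ofReal_pow h1, ← ENNReal.ofReal_mul
      (Finset.prod_nonneg fun j _ => Finset.prod_nonneg fun k _ => h0 k)]
  congr 2
  -- The factor `1 - g k` occurs once for each `j ≠ k`.
  rw [Finset.prod_comm' (t' := Finset.univ) (s' := fun k => Finset.univ.erase k)
    (fun j k => by simp [eq_comm]), ← Finset.prod_pow]
  simp

/-- The probability that an embedding `σ` is the index of an interior generator, as an integral
over the position of that generator. -/
theorem measure_isGeneratorIndex {d n : ℕ} (σ : Fin d ↪ Fin n) :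
    (Measure.pi fun _ => Measure.pi fun _ => unif)
      {u : Fin n → Fin d → ℝ | (∀ j k, k ≠ j → u (σ k) k < u (σ j) k) ∧
        ∀ i : Fin n, ∃ k, u i k ≤ u (σ k) k} =
      ∫⁻ g, ENNReal.ofReal ((∏ k, (1 - g k)) ^ (d - 1) * (1 - ∏ k, (1 - g k)) ^ (n - d))
        ∂(Measure.pi fun _ : Fin d => unif) := by
  have hA : MeasurableSet {u : Fin n → Fin d → ℝ | (∀ j k, k ≠ j → u (σ k) k < u (σ j) k) ∧
        ∀ i : Fin n, ∃ k, u i k ≤ u (σ k) k} := by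
    measurability
  have hT := measurePreserving_resample unif σ
  rw [← hT.measure_preimage hA.nullMeasurableSet, Measure.prod_apply (hT.measurable hA)]
  have hcube : ∀ᵐ g ∂(Measure.pi fun _ : Fin d => unif), g ∈ unitCube d := by
    have := fun k : Fin d => (Measure.quasiMeasurePreserving_eval (fun _ : Fin d => unif) k).ae
      (ae_restrict_mem measurableSet_Ico)
    exact ae_all_iff.mpr this
  refine lintegral_congr_ae (hcube.mono fun g hg => ?_)
  simp only
  rw [← measure_pi_rowEvent σ hg]
  congr 1
  ext u
  rw [← generatorIndex_resample_iff]
  simp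

/-! ### The product of independent uniform variables -/

lemma lintegral_unif_one_sub (f : ℝ → ENNReal) :
    ∫⁻ x, f (1 - x) ∂unif = ∫⁻ p in Set.Ioo 0 1, f p := by
  have h := (Measure.measurePreserving_sub_left volume (1 : ℝ)).setLIntegral_comp_preimage_emb
    (Homeomorph.subLeft (1 : ℝ)).measurableEmbedding f (Set.Ioc 0 1)
  rw [Set.preimage_const_sub_Ioc, sub_self, sub_zero] at h
  rw [h, setLIntegral_congr Ioo_ae_eq_Ioc]

lemma setLIntegral_comp_mul_left {x : ℝ} (hx : 0 < x) (G : ℝ → ENNReal) :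
    ∫⁻ q in Set.Ioo 0 x, G q = ∫⁻ p in Set.Ioo 0 1, ENNReal.ofReal x * G (x * p) := by
  have h := lintegral_image_eq_lintegral_abs_deriv_mul (f := fun p => x * p) (f' := fun _ => x)
    (s := Set.Ioo 0 1) measurableSet_Ioo
    (fun p _ => by simpa using ((hasDerivAt_id p).const_mul x).hasDerivWithinAt)
    (mul_right_injective₀ hx.ne').injOn G
  rwa [Set.image_mul_left_Ioo hx, mul_zero, mul_one, abs_of_pos hx] at h

lemma setLIntegral_log_sub_log_pow {q : ℝ} (hq : q ∈ Set.Ioo (0 : ℝ) 1) (m : ℕ) :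
    ∫⁻ x in Set.Ioo q 1, ENNReal.ofReal ((Real.log x - Real.log q) ^ m / m.factorial * x⁻¹) =
      ENNReal.ofReal ((-Real.log q) ^ (m + 1) / (m + 1).factorial) := by
  have hne : ∀ x ∈ Set.uIcc q 1, x ≠ 0 := by
    intro x hx
    rw [Set.uIcc_of_le hq.2.le] at hx
    exact (hq.1.trans_le hx.1).ne'
  have hcont : ContinuousOn
      (fun x => (Real.log x - Real.log q) ^ m / m.factorial * x⁻¹) (Set.uIcc q 1) := by
    fun_prop (disch := assumption)
  have hint := hcont.intervalIntegrable (μ := volume)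
  have hftc := intervalIntegral.integral_eq_sub_of_hasDerivAt
    (f := fun x => (Real.log x - Real.log q) ^ (m + 1) / (m + 1).factorial)
    (fun x hx => by
      refine ((((Real.hasDerivAt_log (hne x hx)).sub_const (Real.log q)).pow (m + 1)).div_const
        ((m + 1).factorial : ℝ)).congr_deriv ?_
      rw [Nat.factorial_succ]
      push_cast
      field_simp) hint
  rw [intervalIntegral.integral_of_le hq.2.le, integral_Ioc_eq_integral_Ioo] at hftc
  have hint' := (intervalIntegrable_iff_integrableOn_Ioo_of_le hq.2.le).mp hint
  rw [← ofReal_integral_eq_lintegral_ofReal hint', hftc]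
  · simp
  · refine (ae_restrict_mem measurableSet_Ioo).mono fun x hx => ?_
    have h1 : 0 ≤ Real.log x - Real.log q := sub_nonneg.mpr (Real.log_le_log hq.1 hx.1.le)
    have h2 : 0 < x := hq.1.trans hx.1
    simp only [Pi.zero_apply]
    positivity

/-- The product of `m + 1` independent uniform variables has density `(-log p) ^ m / m!` on
`(0, 1)`. -/
theorem lintegral_prod_one_sub (m : ℕ) {f : ℝ → ENNReal} (hf : Measurable f) :
    ∫⁻ g, f (∏ k, (1 - g k)) ∂(Measure.pi fun _ : Fin (m + 1) => unif) =
      ∫⁻ p in Set.Ioo 0 1, f p * ENNReal.ofReal ((-Real.log p) ^ m / m.factorial) := by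
  induction m generalizing f with
  | zero =>
    have h := (measurePreserving_funUnique unif (Fin 1)).lintegral_comp_emb
      (MeasurableEquiv.measurableEmbedding _) (fun x => f (1 - x))
    rw [lintegral_unif_one_sub] at h
    simp only [pow_zero, Nat.factorial_zero, Nat.cast_one, div_one, ENNReal.ofReal_one, mul_one]
    convert h
    exact Fin.prod_univ_one _
  | succ m ih =>
    have h := (measurePreserving_piFinSuccAbove (fun _ : Fin (m + 2) => unif) 0).lintegral_comp_emb
      (MeasurableEquiv.measurableEmbedding _) (fun z => f ((1 - z.1) * ∏ k, (1 - z.2 k)))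
    have hL : ∫⁻ g, f (∏ k, (1 - g k)) ∂(Measure.pi fun _ : Fin (m + 2) => unif) =
        ∫⁻ z, f ((1 - z.1) * ∏ k, (1 - z.2 k))
          ∂(unif.prod (Measure.pi fun _ : Fin (m + 1) => unif)) := by
      rw [← h]
      refine lintegral_congr fun g => ?_
      rw [Fin.prod_univ_succ]
      rfl
    rw [hL, lintegral_prod _ (by fun_prop)]
    simp only
    rw [lintegral_unif_one_sub fun x =>
      ∫⁻ g, f (x * ∏ k, (1 - g k)) ∂(Measure.pi fun _ : Fin (m + 1) => unif)]
    set c : ℝ → ℝ → ENNReal := fun x q =>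
      ENNReal.ofReal ((Real.log x - Real.log q) ^ m / m.factorial * x⁻¹) with hc
    have hstep : ∀ x ∈ Set.Ioo (0 : ℝ) 1,
        ∫⁻ g, f (x * ∏ k, (1 - g k)) ∂(Measure.pi fun _ : Fin (m + 1) => unif) =
          ∫⁻ q in Set.Ioo 0 1, (Set.Iio x).indicator (fun q => f q * c x q) q := by
      intro x hx
      rw [ih (f := fun p => f (x * p)) (by fun_prop), lintegral_indicator measurableSet_Iio,
        Measure.restrict_restrict measurableSet_Iio]
      have : Set.Iio x ∩ Set.Ioo 0 1 = Set.Ioo 0 x := by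
        ext q
        exact ⟨fun h => ⟨h.2.1, h.1⟩, fun h => ⟨h.2, h.1, h.2.trans hx.2⟩⟩
      rw [this, setLIntegral_comp_mul_left hx.1]
      refine setLIntegral_congr_fun measurableSet_Ioo fun p hp => ?_
      simp only [hc]
      rw [mul_left_comm, ← ENNReal.ofReal_mul hx.1.le, Real.log_mul hx.1.ne' hp.1.ne']
      have := hx.1.ne'
      congr 2
      field_simp
      ring_nf
    rw [setLIntegral_congr_fun measurableSet_Ioo hstep, lintegral_lintegral_swap]
    · refine setLIntegral_congr_fun measurableSet_Ioo fun q hq => ?_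
      have hind : ∀ x, (Set.Iio x).indicator (fun q => f q * c x q) q =
          (Set.Ioi q).indicator (fun x => f q * c x q) x := by
        intro x
        simp [Set.indicator_apply]
      simp only [hind]
      rw [lintegral_indicator measurableSet_Ioi, Measure.restrict_restrict measurableSet_Ioi]
      have : Set.Ioi q ∩ Set.Ioo 0 1 = Set.Ioo q 1 := by
        ext x
        exact ⟨fun h => ⟨h.1, h.2.2⟩, fun h => ⟨h.1, hq.1.trans h.1, h.2⟩⟩
      rw [this, lintegral_const_mul _ (by fun_prop), setLIntegral_log_sub_log_pow hq]
    · refine Measurable.aemeasurable ?_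
      have : (Function.uncurry fun x q => (Set.Iio x).indicator (fun q => f q * c x q) q) =
          {z : ℝ × ℝ | z.2 < z.1}.indicator fun z => f z.2 * c z.1 z.2 := by
        ext z
        simp [Function.uncurry, Set.indicator_apply]
      rw [this]
      exact Measurable.indicator (by fun_prop) (measurableSet_lt measurable_snd measurable_fst)

/-! ### The exact expectation -/

variable {d : ℕ} {Ω : Type*} [MeasurableSpace Ω] {P : Measure Ω} {X : ℕ → Ω → Fin d → ℝ}

lemma IsUniformObservations.map_coord (hX : IsUniformObservations P X) (i : ℕ) (k : Fin d) :
    P.map (fun ω => X i ω k) = unif := by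
  have h : P.map (fun ω => X i ω k) = ProbabilityTheory.cond volume (Set.Ico (0 : ℝ) 1) :=
    hX.uniform i k
  simp [h, ProbabilityTheory.cond]

lemma IsUniformObservations.map_array (hX : IsUniformObservations P X) (n : ℕ) :
    P.map (fun ω (i : Fin n) => X i ω) = Measure.pi fun _ => Measure.pi fun _ => unif := by
  have hind : iIndepFun (fun i : Fin n => X i) P :=
    hX.indep_observations.precomp Fin.val_injective
  rw [iIndepFun.map_fun_eq_pi_map (f := fun i : Fin n => X i)
    (fun i => (hX.measurable i).aemeasurable) hind]
  congr 1
  funext i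
  have h := (hX.indep_coordinates i).map_fun_eq_pi_map
    fun k => ((measurable_pi_apply k).comp (hX.measurable i)).aemeasurable
  exact h.trans (congrArg Measure.pi (funext (hX.map_coord i)))

lemma measurableSet_isGeneratorIndex {n : ℕ} (σ : Fin d ↪ Fin n) :
    MeasurableSet {u : Fin n → Fin d → ℝ | (∀ j k, k ≠ j → u (σ k) k < u (σ j) k) ∧
      ∀ i : Fin n, ∃ k, u i k ≤ u (σ k) k} := by
  measurability

/-- The expected number of interior generators after `n` observations in dimension `d`, as an
integral over the volume `p` of the box strictly above a generator. For `n < d` the factor in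
front vanishes, so the truncated exponent `n - d` is harmless. -/
noncomputable def expectedCount (d n : ℕ) : ℝ :=
  n.descFactorial d * (∫⁻ p in Set.Ioo (0 : ℝ) 1,
    ENNReal.ofReal (p ^ (d - 1) * (1 - p) ^ (n - d)) *
      ENNReal.ofReal ((-Real.log p) ^ (d - 1) / (d - 1).factorial)).toReal

lemma IsUniformObservations.measure_isGeneratorIndex (hX : IsUniformObservations P X) (hd : 1 ≤ d)
    {n : ℕ} (σ : Fin d ↪ Fin n) :
    P {ω | IsGeneratorIndex (fun i => X i ω) σ} = ∫⁻ p in Set.Ioo (0 : ℝ) 1,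
      ENNReal.ofReal (p ^ (d - 1) * (1 - p) ^ (n - d)) *
        ENNReal.ofReal ((-Real.log p) ^ (d - 1) / (d - 1).factorial) := by
  have hm : Measurable fun ω (i : Fin n) => X i ω :=
    measurable_pi_lambda _ fun i => hX.measurable i
  have h := ParetoRecords.measure_isGeneratorIndex σ
  rw [← hX.map_array n, Measure.map_apply hm (measurableSet_isGeneratorIndex σ)] at h
  obtain ⟨m, rfl⟩ := Nat.exists_eq_add_of_le' hd
  exact h.trans (lintegral_prod_one_sub m
    (f := fun p => ENNReal.ofReal (p ^ m * (1 - p) ^ (n - (m + 1)))) (by fun_prop))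

variable [IsProbabilityMeasure P]

lemma IsUniformObservations.ae_ne (hX : IsUniformObservations P X) {i i' : ℕ} (h : i ≠ i')
    (k : Fin d) : ∀ᵐ ω ∂P, X i ω k ≠ X i' ω k := by
  have hm : ∀ i, Measurable fun ω => X i ω k := fun i =>
    (measurable_pi_apply k).comp (hX.measurable i)
  have hind : IndepFun (fun ω => X i ω k) (fun ω => X i' ω k) P :=
    (hX.indep_observations.indepFun h).comp (measurable_pi_apply k) (measurable_pi_apply k)
  have hlaw := (indepFun_iff_map_prod_eq_prod_map_map (hm i).aemeasurable (hm i').aemeasurable).mp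
    hind
  rw [hX.map_coord, hX.map_coord] at hlaw
  have hnull : ∀ᵐ z ∂(unif.prod unif), z.1 ≠ z.2 := by
    have hms : MeasurableSet {z : ℝ × ℝ | z.1 = z.2} :=
      measurableSet_eq_fun measurable_fst measurable_snd
    rw [ae_iff]
    simp only [not_not]
    rw [Measure.measure_prod_null hms]
    refine Filter.Eventually.of_forall fun x => ?_
    have : (Prod.mk x ⁻¹' {z : ℝ × ℝ | z.1 = z.2}) = {x} := by ext; simp [eq_comm]
    simp [this]
  rw [← hlaw] at hnull
  exact ae_of_ae_map ((hm i).prodMk (hm i')).aemeasurable hnull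

lemma IsUniformObservations.ae_inGeneralPosition (hX : IsUniformObservations P X) (n : ℕ) :
    ∀ᵐ ω ∂P, InGeneralPosition (fun i => X i ω) n := by
  have h1 : ∀ᵐ ω ∂P, ∀ i k, X i ω k ∈ Set.Ioo (0 : ℝ) 1 := by
    refine ae_all_iff.mpr fun i => ae_all_iff.mpr fun k => ?_
    have hu : ∀ᵐ y ∂unif, y ∈ Set.Ioo (0 : ℝ) 1 := by
      rw [unif, ← Measure.restrict_congr_set Ioo_ae_eq_Ico]
      exact ae_restrict_mem measurableSet_Ioo
    rw [← hX.map_coord i k] at hu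
    exact ae_of_ae_map ((measurable_pi_apply k).comp (hX.measurable i)).aemeasurable hu
  have h2 : ∀ᵐ ω ∂P, ∀ i i' k, i ≠ i' → X i ω k ≠ X i' ω k := by
    refine ae_all_iff.mpr fun i => ae_all_iff.mpr fun i' => ae_all_iff.mpr fun k => ?_
    by_cases h : i = i'
    · simp [h]
    · exact (hX.ae_ne h k).mono fun ω hω _ => hω
  filter_upwards [h1, h2] with ω hω1 hω2
  exact ⟨fun i _ k => hω1 i k, fun i _ i' _ k h => by_contra fun hne => hω2 i i' k hne h⟩

/-- Finiteness, integrability and exact expectation of the number of interior generators. -/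
theorem IsUniformObservations.expectation (hX : IsUniformObservations P X) (hd : 1 ≤ d) (n : ℕ) :
    (∀ᵐ ω ∂P, (interiorGenerators (fun i => X i ω) n).Finite) ∧
      Integrable (fun ω => (numInteriorGenerators X n ω : ℝ)) P ∧
      ∫ ω, (numInteriorGenerators X n ω : ℝ) ∂P = expectedCount d n := by
  classical
  have hgp := hX.ae_inGeneralPosition n
  set A : (Fin d ↪ Fin n) → Set Ω := fun σ => {ω | IsGeneratorIndex (fun i => X i ω) σ} with hA
  have hAm : ∀ σ, MeasurableSet (A σ) := fun σ =>
    (measurable_pi_lambda (fun ω (i : Fin n) => X i ω) fun i => hX.measurable i)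
      (measurableSet_isGeneratorIndex σ)
  have hae : (fun ω => (numInteriorGenerators X n ω : ℝ)) =ᵐ[P]
      fun ω => ∑ σ, (A σ).indicator 1 ω := by
    filter_upwards [hgp] with ω hω
    rw [numInteriorGenerators, ncard_interiorGenerators hω]
    push_cast
    exact Finset.sum_congr rfl fun σ _ => by simp [Set.indicator_apply, hA]
  have hi : ∀ σ, Integrable ((A σ).indicator (1 : Ω → ℝ)) P := fun σ =>
    (integrable_const (1 : ℝ)).indicator (hAm σ)
  refine ⟨?_, (integrable_finsetSum _ fun σ _ => hi σ).congr hae.symm, ?_⟩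
  · filter_upwards [hgp] with ω hω
    rw [interiorGenerators_eq_image hω]
    exact Set.toFinite _
  · rw [integral_congr_ae hae, integral_finsetSum _ fun σ _ => hi σ]
    simp only [integral_indicator_one (hAm _), Measure.real]
    simp only [hA, hX.measure_isGeneratorIndex hd]
    rw [Finset.sum_const, Finset.card_univ, Fintype.card_embedding_eq, Fintype.card_fin,
      Fintype.card_fin, nsmul_eq_mul, expectedCount]

/-! ### Derivatives of the gamma function -/

/-- The measure `e⁻ᵗ dt` on the positive half-line. The moment generating function of `log` under
this measure is the gamma function, shifted by one. -/
noncomputable def expMeasure : Measure ℝ :=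
  (volume.restrict (Set.Ioi 0)).withDensity fun t => ENNReal.ofReal (Real.exp (-t))

lemma integrable_expMeasure_iff {f : ℝ → ℝ} :
    Integrable f expMeasure ↔ IntegrableOn (fun t => Real.exp (-t) * f t) (Set.Ioi 0) := by
  rw [expMeasure, integrable_withDensity_iff_integrable_smul' (by fun_prop) (by simp)]
  simp [IntegrableOn, ENNReal.toReal_ofReal, Real.exp_nonneg]

lemma integral_expMeasure (f : ℝ → ℝ) :
    ∫ t, f t ∂expMeasure = ∫ t in Set.Ioi 0, Real.exp (-t) * f t := by
  rw [expMeasure, integral_withDensity_eq_integral_toReal_smul (by fun_prop) (by simp)]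
  simp [ENNReal.toReal_ofReal, Real.exp_nonneg]

lemma exp_mul_log_eq_rpow {v t : ℝ} (ht : t ∈ Set.Ioi (0 : ℝ)) :
    Real.exp (v * Real.log t) = t ^ v := by
  rw [Real.rpow_def_of_pos ht, mul_comm]

lemma Ioi_subset_integrableExpSet_log :
    Set.Ioi (-1) ⊆ integrableExpSet Real.log expMeasure := by
  intro v hv
  refine integrable_expMeasure_iff.mpr ?_
  refine (Real.GammaIntegral_convergent (s := v + 1) (by linarith [Set.mem_Ioi.mp hv])).congr_fun
    (fun t ht => ?_) measurableSet_Ioi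
  simp only [exp_mul_log_eq_rpow ht, add_sub_cancel_right]

lemma mem_interior_integrableExpSet_log (m : ℕ) :
    (m : ℝ) ∈ interior (integrableExpSet Real.log expMeasure) := by
  rw [mem_interior]
  exact ⟨_, Ioi_subset_integrableExpSet_log, isOpen_Ioi, by
    have : (0 : ℝ) ≤ m := m.cast_nonneg
    simp only [Set.mem_Ioi]; linarith⟩

lemma mgf_log_expMeasure {v : ℝ} (hv : -1 < v) :
    mgf Real.log expMeasure v = Real.Gamma (v + 1) := by
  rw [mgf, integral_expMeasure, Real.Gamma_eq_integral (by linarith)]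
  refine setIntegral_congr_fun measurableSet_Ioi fun t ht => ?_
  simp only [exp_mul_log_eq_rpow ht, add_sub_cancel_right]

lemma exp_natCast_mul_log {m : ℕ} {t : ℝ} (ht : t ∈ Set.Ioi (0 : ℝ)) :
    Real.exp (m * Real.log t) = t ^ m := by
  rw [exp_mul_log_eq_rpow ht, Real.rpow_natCast]

/-- The derivatives of the gamma function at positive integers, as integrals. -/
theorem iteratedDeriv_Gamma_natCast_add_one (j m : ℕ) :
    iteratedDeriv j Real.Gamma (m + 1) =
      ∫ t in Set.Ioi 0, Real.exp (-t) * (Real.log t ^ j * t ^ m) := by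
  have h : (fun v => Real.Gamma (v + 1)) =ᶠ[nhds (m : ℝ)] mgf Real.log expMeasure := by
    have : (-1 : ℝ) < m := by
      have : (0 : ℝ) ≤ m := m.cast_nonneg
      linarith
    filter_upwards [Ioi_mem_nhds this] with v hv
    exact (mgf_log_expMeasure hv).symm
  have h2 := h.iteratedDeriv_eq j
  rw [iteratedDeriv_comp_add_const, iteratedDeriv_mgf (mem_interior_integrableExpSet_log m),
    integral_expMeasure] at h2
  refine h2.trans (setIntegral_congr_fun measurableSet_Ioi fun t ht => ?_)
  simp only [exp_natCast_mul_log ht]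

lemma integrableOn_exp_mul_log_pow (j m : ℕ) :
    IntegrableOn (fun t => Real.exp (-t) * (Real.log t ^ j * t ^ m)) (Set.Ioi 0) := by
  refine (integrable_expMeasure_iff.mp (integrable_pow_mul_exp_of_mem_interior_integrableExpSet
    (mem_interior_integrableExpSet_log m) j)).congr_fun (fun t ht => ?_) measurableSet_Ioi
  simp only [exp_natCast_mul_log ht]

lemma integrableOn_exp_mul_abs_log_pow (j m : ℕ) :
    IntegrableOn (fun t => Real.exp (-t) * (|Real.log t| ^ j * t ^ m)) (Set.Ioi 0) := by
  refine (integrable_expMeasure_iff.mp (integrable_pow_abs_mul_exp_of_mem_interior_integrableExpSet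
    (mem_interior_integrableExpSet_log m) j)).congr_fun (fun t ht => ?_) measurableSet_Ioi
  simp only [exp_natCast_mul_log ht]

lemma integrableOn_exp_mul_one_add_abs_log_pow (j m : ℕ) :
    IntegrableOn (fun t => Real.exp (-t) * ((1 + |Real.log t|) ^ j * t ^ m)) (Set.Ioi 0) := by
  have : (fun t => Real.exp (-t) * ((1 + |Real.log t|) ^ j * t ^ m)) = fun t =>
      ∑ i ∈ Finset.range (j + 1),
        (j.choose i : ℝ) * (Real.exp (-t) * (|Real.log t| ^ i * t ^ m)) := by
    funext t
    rw [add_comm, add_pow, Finset.sum_mul, Finset.mul_sum]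
    refine Finset.sum_congr rfl fun i _ => ?_
    rw [one_pow]; ring
  rw [this]
  exact integrable_finsetSum _ fun i _ => (integrableOn_exp_mul_abs_log_pow i m).const_mul _

lemma exp_mul_sub_log_pow_eq_sum (m : ℕ) (L t : ℝ) :
    Real.exp (-t) * ((L - Real.log t) ^ m * t ^ m) = ∑ j ∈ Finset.range (m + 1),
      (m.choose j * (-1) ^ j * L ^ (m - j)) * (Real.exp (-t) * (Real.log t ^ j * t ^ m)) := by
  rw [sub_eq_neg_add, add_pow, Finset.sum_mul, Finset.mul_sum]
  refine Finset.sum_congr rfl fun j _ => ?_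
  rw [neg_pow]; ring

lemma integrableOn_exp_mul_sub_log_pow (m : ℕ) (L : ℝ) :
    IntegrableOn (fun t => Real.exp (-t) * ((L - Real.log t) ^ m * t ^ m)) (Set.Ioi 0) := by
  simp only [exp_mul_sub_log_pow_eq_sum]
  exact integrable_finsetSum _ fun j _ => (integrableOn_exp_mul_log_pow j m).const_mul _

/-- The main term of the expansion is the integral that arises in the limit. -/
lemma integral_exp_mul_sub_log_pow (m : ℕ) {L : ℝ} (hL : L ≠ 0) :
    L ^ m * (∑ j ∈ Finset.range (m + 1),
      (-1 : ℝ) ^ j * iteratedDeriv j Real.Gamma (m + 1) / (j.factorial * (m - j).factorial) *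
        L ^ (-(j : ℤ))) =
      (∫ t in Set.Ioi 0, Real.exp (-t) * ((L - Real.log t) ^ m * t ^ m)) / m.factorial := by
  simp only [exp_mul_sub_log_pow_eq_sum]
  rw [integral_finsetSum _ fun j _ => (integrableOn_exp_mul_log_pow j m).const_mul _,
    Finset.mul_sum, Finset.sum_div]
  refine Finset.sum_congr rfl fun j hj => ?_
  have hjm : j ≤ m := Nat.lt_succ_iff.mp (Finset.mem_range.mp hj)
  rw [integral_const_mul, ← iteratedDeriv_Gamma_natCast_add_one, Nat.cast_choose ℝ hjm,
    zpow_neg, zpow_natCast, pow_sub₀ _ hL hjm]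
  have := m.factorial_ne_zero
  field_simp

/-! ### Asymptotics of the exact expectation -/

/-- Comparison of `(1 - t / n) ^ (n - d)` with its limit `e⁻ᵗ`. -/
lemma abs_one_sub_div_pow_sub_exp_le {d n : ℕ} (hn : 0 < n) (hdn : d ≤ n) {t : ℝ} (ht : 0 < t) :
    |(if t < n then (1 - t / n) ^ (n - d) else 0) - Real.exp (-t)| ≤
      Real.exp (-t) * (t ^ 2 + (d * Real.exp d + 1) * t) / n := by
  have hn' : (0 : ℝ) < n := Nat.cast_pos.mpr hn
  have hE := Real.exp_pos (-t)
  split_ifs with htn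
  · -- With `a = 1 - t / n`, the power `a ^ n` lies between `e⁻ᵗ (1 - t² / n)` and `e⁻ᵗ`; passing to
    -- the exponent `n - d` costs at most a factor `e ^ d` and a relative error `d t / n`.
    set a := 1 - t / n with ha
    have htn1 : t / n < 1 := (div_lt_one hn').mpr htn
    have htn0 : 0 < t / n := by positivity
    have ha0 : 0 < a := by linarith
    have ha1 : a ≤ 1 := by linarith
    have hup : a ^ n ≤ Real.exp (-t) := Real.one_sub_div_pow_le_exp_neg htn.le
    -- Bernoulli's inequality for `(a (1 + t / n)) ^ n = (1 - t² / n²) ^ n`.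
    have hlow : Real.exp (-t) * (1 - t ^ 2 / n) ≤ a ^ n := by
      have h1 : 1 - t ^ 2 / n ≤ (a * (1 + t / n)) ^ n := by
        have h := one_add_mul_le_pow (a := -(t / n) ^ 2) (by nlinarith) n
        have e1 : 1 + (n : ℝ) * -(t / n) ^ 2 = 1 - t ^ 2 / n := by field_simp; ring
        have e2 : a * (1 + t / n) = 1 + -(t / n) ^ 2 := by rw [ha]; ring
        rw [e2, ← e1]; exact h
      have h2 : (1 + t / n) ^ n ≤ Real.exp t := by
        calc (1 + t / n) ^ n ≤ Real.exp (t / n) ^ n := by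
              gcongr; rw [add_comm]; exact Real.add_one_le_exp _
          _ = Real.exp t := by rw [← Real.exp_nat_mul]; congr 1; field_simp
      calc Real.exp (-t) * (1 - t ^ 2 / n) ≤ Real.exp (-t) * (a ^ n * Real.exp t) := by
            rw [mul_pow] at h1
            gcongr
            exact h1.trans (by gcongr)
        _ = a ^ n := by rw [mul_left_comm, ← Real.exp_add]; simp
    have hmono : a ^ n ≤ a ^ (n - d) := pow_le_pow_of_le_one ha0.le ha1 (Nat.sub_le _ _)
    have hbig : a ^ (n - d) ≤ Real.exp (-t) * Real.exp d := by
      calc a ^ (n - d) ≤ Real.exp (-(t / n)) ^ (n - d) := by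
            gcongr; exact Real.one_sub_le_exp_neg _
        _ = Real.exp (-t + t / n * d) := by
            rw [← Real.exp_nat_mul, Nat.cast_sub hdn]; congr 1; field_simp; ring
        _ ≤ Real.exp (-t + d) := by
            gcongr; exact mul_le_of_le_one_left (Nat.cast_nonneg _) htn1.le
        _ = _ := Real.exp_add _ _
    have hdiff : a ^ (n - d) - a ^ n ≤ Real.exp (-t) * Real.exp d * (d * (t / n)) := by
      have h1 : 1 - a ^ d ≤ d * (t / n) := by
        have h := one_add_mul_le_pow (a := -(t / n)) (by linarith) d
        have e : 1 + -(t / n) = a := by rw [ha]; ring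
        rw [e] at h
        linarith
      calc a ^ (n - d) - a ^ n = a ^ (n - d) * (1 - a ^ d) := by
            rw [mul_sub, ← pow_add, Nat.sub_add_cancel hdn, mul_one]
        _ ≤ _ := by
            have : 0 ≤ 1 - a ^ d := sub_nonneg.mpr (pow_le_one₀ ha0.le ha1)
            gcongr
    have e : Real.exp (-t) * (t ^ 2 + (d * Real.exp d + 1) * t) / n =
        Real.exp (-t) * (t ^ 2 / n) + Real.exp (-t) * Real.exp d * (d * (t / n)) +
          Real.exp (-t) * (t / n) := by ring
    have p1 : 0 ≤ Real.exp (-t) * (t ^ 2 / n) := by positivity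
    have p2 : 0 ≤ Real.exp (-t) * Real.exp d * (d * (t / n)) := by positivity
    have p3 : 0 ≤ Real.exp (-t) * (t / n) := by positivity
    rw [e, abs_le]
    constructor <;> linarith
  · rw [zero_sub, abs_neg, abs_of_pos hE, le_div_iff₀ hn']
    have : (n : ℝ) ≤ t := not_lt.mp htn
    gcongr
    nlinarith [mul_nonneg (mul_nonneg (Nat.cast_nonneg (α := ℝ) d) (Real.exp_pos d).le) ht.le,
      sq_nonneg t]

/-- The rescaled integrand of `expectedCount (m + 1) n`, under `p = t / n`. -/
noncomputable def rescaledIntegrand (m n : ℕ) (t : ℝ) : ℝ :=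
  (if t < n then (1 - t / n) ^ (n - (m + 1)) else 0) * ((Real.log n - Real.log t) ^ m * t ^ m)

lemma measurable_rescaledIntegrand (m n : ℕ) : Measurable (rescaledIntegrand m n) := by
  unfold rescaledIntegrand
  refine Measurable.mul ?_ (by fun_prop)
  exact Measurable.ite (measurableSet_lt measurable_id measurable_const) (by fun_prop)
    measurable_const

lemma expectedCount_eq (m : ℕ) {n : ℕ} (hn : 0 < n) :
    expectedCount (m + 1) n = n.descFactorial (m + 1) / n ^ (m + 1) *
      ((∫ t in Set.Ioi 0, rescaledIntegrand m n t) / m.factorial) := by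
  have hn' : (0 : ℝ) < n := Nat.cast_pos.mpr hn
  have hscale := integral_comp_mul_left_Ioi (rescaledIntegrand m n) 0 hn'
  rw [mul_zero, smul_eq_mul] at hscale
  have hint : ∫ p in Set.Ioi 0, rescaledIntegrand m n (n * p) =
      n ^ m * ∫ p in Set.Ioo (0 : ℝ) 1, p ^ m * (1 - p) ^ (n - (m + 1)) * (-Real.log p) ^ m := by
    rw [← integral_const_mul, ← Set.Ioi_inter_Iio, ← setIntegral_indicator measurableSet_Iio]
    refine setIntegral_congr_fun measurableSet_Ioi fun p hp => ?_
    have hp0 : 0 < p := hp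
    simp only [rescaledIntegrand, Set.indicator_apply, Set.mem_Iio]
    have e1 : (n : ℝ) * p < n ↔ p < 1 := by
      constructor <;> intro h <;> nlinarith
    simp only [e1]
    split_ifs
    · rw [Real.log_mul hn'.ne' hp0.ne', mul_div_cancel_left₀ _ hn'.ne']
      ring
    · simp
  have htoReal : (∫⁻ p in Set.Ioo (0 : ℝ) 1,
      ENNReal.ofReal (p ^ m * (1 - p) ^ (n - (m + 1))) *
        ENNReal.ofReal ((-Real.log p) ^ m / m.factorial)).toReal =
      (∫ p in Set.Ioo (0 : ℝ) 1, p ^ m * (1 - p) ^ (n - (m + 1)) * (-Real.log p) ^ m) /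
        m.factorial := by
    rw [← integral_div, integral_eq_lintegral_of_nonneg_ae]
    · congr 1
      refine setLIntegral_congr_fun measurableSet_Ioo fun p hp => ?_
      have h1 : 0 ≤ p := hp.1.le
      have h2 : 0 ≤ 1 - p := sub_nonneg.mpr hp.2.le
      rw [← ENNReal.ofReal_mul (by positivity), mul_div_assoc]
    · refine (ae_restrict_mem measurableSet_Ioo).mono fun p hp => ?_
      have h1 : 0 ≤ p := hp.1.le
      have h2 : 0 ≤ 1 - p := sub_nonneg.mpr hp.2.le
      have h3 : 0 ≤ -Real.log p := neg_nonneg.mpr (Real.log_nonpos h1 hp.2.le)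
      simp only [Pi.zero_apply]
      positivity
    · exact Measurable.aestronglyMeasurable (by fun_prop)
  rw [expectedCount, Nat.add_sub_cancel, htoReal]
  rw [hint] at hscale
  have : (∫ p in Set.Ioo (0 : ℝ) 1, p ^ m * (1 - p) ^ (n - (m + 1)) * (-Real.log p) ^ m) =
      (∫ t in Set.Ioi 0, rescaledIntegrand m n t) / n ^ (m + 1) := by
    rw [eq_div_iff (by positivity), pow_succ, mul_comm, mul_right_comm, hscale]
    field_simp
  rw [this]
  ring

lemma abs_descFactorial_div_pow_sub_one_le (d : ℕ) {n : ℕ} (hdn : d ≤ n) (hn : 0 < n) :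
    |(n.descFactorial d : ℝ) / n ^ d - 1| ≤ d ^ 2 / n := by
  have hn' : (0 : ℝ) < n := Nat.cast_pos.mpr hn
  have hle : (n.descFactorial d : ℝ) / n ^ d ≤ 1 :=
    div_le_one_of_le₀ (by exact_mod_cast Nat.descFactorial_le_pow n d) (by positivity)
  have hdn' : (d : ℝ) / n ≤ 1 := div_le_one_of_le₀ (by exact_mod_cast hdn) hn'.le
  have hge : 1 - (d : ℝ) ^ 2 / n ≤ (n.descFactorial d : ℝ) / n ^ d := by
    calc 1 - (d : ℝ) ^ 2 / n = 1 + d * -((d : ℝ) / n) := by ring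
      _ ≤ (1 + -((d : ℝ) / n)) ^ d := one_add_mul_le_pow (by linarith) d
      _ = ((n - d : ℕ) : ℝ) ^ d / n ^ d := by
          rw [← div_pow, Nat.cast_sub hdn]; congr 1; field_simp; ring
      _ ≤ _ := by
          gcongr
          have h := Nat.pow_sub_le_descFactorial n d
          exact_mod_cast (Nat.pow_le_pow_left (by omega) d).trans h
  rw [abs_le]
  constructor <;> linarith [show (0 : ℝ) ≤ d ^ 2 / n by positivity]

/-- The weight `(1 + |log t|) ^ m` absorbs the logarithm of `t` once `L = log n` is at least `1`. -/
lemma abs_sub_log_pow_le (m : ℕ) {L : ℝ} (hL : 1 ≤ L) (t : ℝ) :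
    |(L - Real.log t) ^ m| ≤ L ^ m * (1 + |Real.log t|) ^ m := by
  rw [abs_pow, ← mul_pow]
  gcongr
  calc |L - Real.log t| ≤ |L| + |Real.log t| := abs_sub _ _
    _ ≤ L * (1 + |Real.log t|) := by
      rw [abs_of_pos (by linarith)]
      nlinarith [abs_nonneg (Real.log t)]

/-- Both the dominated integral and the limiting one are controlled by fixed constants times
`(log n) ^ m`. -/
theorem exists_integral_bounds (m : ℕ) : ∃ C : ℝ, 0 ≤ C ∧ ∀ n : ℕ, m + 1 ≤ n → 1 ≤ Real.log n →
    |∫ t in Set.Ioi 0, Real.exp (-t) * ((Real.log n - Real.log t) ^ m * t ^ m)| ≤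
        C * Real.log n ^ m ∧
      |(∫ t in Set.Ioi 0, rescaledIntegrand m n t) -
        ∫ t in Set.Ioi 0, Real.exp (-t) * ((Real.log n - Real.log t) ^ m * t ^ m)| ≤
        C * ((n : ℝ)⁻¹ * Real.log n ^ m) := by
  set w : ℕ → ℝ → ℝ := fun k t => Real.exp (-t) * ((1 + |Real.log t|) ^ m * t ^ k) with hw
  have hwint : ∀ k, IntegrableOn (w k) (Set.Ioi 0) := integrableOn_exp_mul_one_add_abs_log_pow m
  set B : ℝ := ((m + 1 : ℕ) : ℝ) * Real.exp (m + 1 : ℕ) + 1 with hB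
  have hw0 : ∀ k, 0 ≤ ∫ t in Set.Ioi 0, w k t := fun k =>
    setIntegral_nonneg measurableSet_Ioi fun t ht => by
      have : 0 < t := ht
      simp only [hw]; positivity
  have hB0 : 0 ≤ B := by positivity
  refine ⟨(∫ t in Set.Ioi 0, w m t) +
    ((∫ t in Set.Ioi 0, w (m + 2) t) + B * ∫ t in Set.Ioi 0, w (m + 1) t),
    by have := hw0 m; have := hw0 (m + 1); have := hw0 (m + 2); positivity, fun n hmn hL => ?_⟩
  have hn : 0 < n := by omega
  have hn' : (0 : ℝ) < n := Nat.cast_pos.mpr hn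
  set L := Real.log n
  have hL0 : 0 ≤ L ^ m := by positivity
  constructor
  · have h1 : |∫ t in Set.Ioi 0, Real.exp (-t) * ((L - Real.log t) ^ m * t ^ m)| ≤
        ∫ t in Set.Ioi 0, L ^ m * w m t := by
      rw [← Real.norm_eq_abs]
      refine norm_integral_le_of_norm_le ((hwint m).const_mul _)
        ((ae_restrict_mem measurableSet_Ioi).mono fun t ht => ?_)
      have ht0 : 0 < t := ht
      rw [Real.norm_eq_abs, abs_mul, abs_mul, Real.abs_exp, abs_of_pos (pow_pos ht0 m)]
      calc _ ≤ Real.exp (-t) * (L ^ m * (1 + |Real.log t|) ^ m * t ^ m) := by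
            gcongr; exact abs_sub_log_pow_le m hL t
        _ = _ := by simp only [hw]; ring
    rw [integral_const_mul] at h1
    refine h1.trans ?_
    rw [mul_comm]
    gcongr
    have := hw0 (m + 1); have := hw0 (m + 2)
    have : 0 ≤ (∫ t in Set.Ioi 0, w (m + 2) t) + B * ∫ t in Set.Ioi 0, w (m + 1) t := by
      positivity
    linarith
  · have hdom : IntegrableOn
        (fun t => ((n : ℝ)⁻¹ * L ^ m) * (w (m + 2) t + B * w (m + 1) t)) (Set.Ioi 0) :=
      ((hwint (m + 2)).add ((hwint (m + 1)).const_mul B)).const_mul _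
    have hbound : ∀ᵐ t ∂(volume.restrict (Set.Ioi (0 : ℝ))),
        ‖rescaledIntegrand m n t - Real.exp (-t) * ((L - Real.log t) ^ m * t ^ m)‖ ≤
          ((n : ℝ)⁻¹ * L ^ m) * (w (m + 2) t + B * w (m + 1) t) := by
      refine (ae_restrict_mem measurableSet_Ioi).mono fun t ht => ?_
      have ht0 : 0 < t := ht
      rw [rescaledIntegrand, ← sub_mul, Real.norm_eq_abs, abs_mul, abs_mul,
        abs_of_pos (pow_pos ht0 m)]
      calc _ ≤ (Real.exp (-t) * (t ^ 2 + B * t) / n) *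
            (L ^ m * (1 + |Real.log t|) ^ m * t ^ m) := by
            gcongr
            · exact abs_one_sub_div_pow_sub_exp_le hn hmn ht0
            · exact abs_sub_log_pow_le m hL t
        _ = _ := by simp only [hw]; ring
    have hG := integrableOn_exp_mul_sub_log_pow m L
    have hdiff : IntegrableOn
        (fun t => rescaledIntegrand m n t - Real.exp (-t) * ((L - Real.log t) ^ m * t ^ m))
        (Set.Ioi 0) :=
      hdom.mono' ((measurable_rescaledIntegrand m n).sub (by fun_prop)).aestronglyMeasurable hbound
    have hJ : IntegrableOn (rescaledIntegrand m n) (Set.Ioi 0) :=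
      (hdiff.add hG).congr_fun (fun t _ => sub_add_cancel _ _) measurableSet_Ioi
    rw [← integral_sub hJ hG, ← Real.norm_eq_abs]
    refine (norm_integral_le_of_norm_le hdom hbound).trans ?_
    rw [integral_const_mul, integral_add (hwint (m + 2)) ((hwint (m + 1)).const_mul B),
      integral_const_mul, mul_comm]
    exact mul_le_mul_of_nonneg_right (le_add_of_nonneg_left (hw0 m)) (by positivity)

/-- The asymptotic expansion of the exact expectation. -/
theorem expectedCount_sub_isBigO (m : ℕ) :
    (fun n : ℕ => expectedCount (m + 1) n - Real.log n ^ m *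
      (∑ j ∈ Finset.range (m + 1),
        (-1 : ℝ) ^ j * iteratedDeriv j Real.Gamma (m + 1) / (j.factorial * (m - j).factorial) *
          Real.log n ^ (-(j : ℤ)))) =O[Filter.atTop]
      fun n : ℕ => (n : ℝ)⁻¹ * Real.log n ^ m := by
  obtain ⟨C, hC, hbd⟩ := exists_integral_bounds m
  refine Asymptotics.IsBigO.of_bound (C + ((m + 1 : ℕ) : ℝ) ^ 2 * C) ?_
  have hlog : ∀ᶠ n : ℕ in Filter.atTop, 1 ≤ Real.log n :=
    (Real.tendsto_log_atTop.comp tendsto_natCast_atTop_atTop).eventually_ge_atTop 1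
  filter_upwards [hlog, Filter.eventually_ge_atTop (m + 1)] with n hL hn
  have hn0 : 0 < n := by omega
  have hn' : (0 : ℝ) < n := Nat.cast_pos.mpr hn0
  obtain ⟨hG, hJ⟩ := hbd n hn hL
  have hρ := abs_descFactorial_div_pow_sub_one_le (m + 1) hn hn0
  have hρ1 : |(n.descFactorial (m + 1) : ℝ) / n ^ (m + 1)| ≤ 1 := by
    rw [abs_of_nonneg (by positivity)]
    exact div_le_one_of_le₀ (by exact_mod_cast Nat.descFactorial_le_pow n (m + 1)) (by positivity)
  rw [integral_exp_mul_sub_log_pow m (by linarith), expectedCount_eq m hn0]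
  set ρ := (n.descFactorial (m + 1) : ℝ) / n ^ (m + 1)
  set J := ∫ t in Set.Ioi 0, rescaledIntegrand m n t
  set G := ∫ t in Set.Ioi 0, Real.exp (-t) * ((Real.log n - Real.log t) ^ m * t ^ m)
  have hfac : (1 : ℝ) ≤ m.factorial := by exact_mod_cast m.factorial_pos
  rw [Real.norm_eq_abs, Real.norm_eq_abs,
    abs_of_nonneg (a := (n : ℝ)⁻¹ * Real.log n ^ m) (by positivity)]
  calc |ρ * (J / m.factorial) - G / m.factorial|
      = |ρ * (J - G) + (ρ - 1) * G| / m.factorial := by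
        rw [← abs_of_pos (a := (m.factorial : ℝ)) (by linarith), ← abs_div,
          abs_of_pos (a := (m.factorial : ℝ)) (by linarith)]
        congr 1
        ring
    _ ≤ |ρ * (J - G) + (ρ - 1) * G| := div_le_self (abs_nonneg _) hfac
    _ ≤ |ρ| * |J - G| + |ρ - 1| * |G| := by
        rw [← abs_mul, ← abs_mul]
        exact abs_add_le _ _
    _ ≤ 1 * (C * ((n : ℝ)⁻¹ * Real.log n ^ m)) +
          (((m + 1 : ℕ) : ℝ) ^ 2 / n) * (C * Real.log n ^ m) := by
        gcongr
    _ = _ := by ring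

end ParetoRecords

/-- The expected number of interior generators after `n` observations is finite and has the stated
expansion; the remainder `E` depends on `d` and `n` only, not on the probability space. -/
theorem theoremT (d : ℕ) (hd : 1 ≤ d) :
    ∃ E : ℕ → ℝ,
      E =O[Filter.atTop] (fun n : ℕ => (n : ℝ)⁻¹ * Real.log n ^ (d - 1)) ∧
      ∀ (Ω : Type*) [MeasurableSpace Ω] (P : MeasureTheory.Measure Ω)
        [MeasureTheory.IsProbabilityMeasure P] (X : ℕ → Ω → Fin d → ℝ),
        ParetoRecords.IsUniformObservations P X →
        ∀ n : ℕ,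
          (∀ᵐ ω ∂P, (ParetoRecords.interiorGenerators (fun i => X i ω) n).Finite) ∧
          MeasureTheory.Integrable
            (fun ω => (ParetoRecords.numInteriorGenerators X n ω : ℝ)) P ∧
          ∫ ω, (ParetoRecords.numInteriorGenerators X n ω : ℝ) ∂P =
            Real.log n ^ (d - 1) *
              (∑ j ∈ Finset.range d,
                (-1 : ℝ) ^ j * iteratedDeriv j Real.Gamma (d : ℝ) /
                    ((Nat.factorial j : ℝ) * (Nat.factorial (d - 1 - j) : ℝ)) *
                  Real.log n ^ (-(j : ℤ))) + E n := by
  obtain ⟨m, rfl⟩ := Nat.exists_eq_add_of_le' hd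
  refine ⟨_, ParetoRecords.expectedCount_sub_isBigO m, fun Ω _ P _ X hX n => ?_⟩
  obtain ⟨h1, h2, h3⟩ := hX.expectation hd n
  refine ⟨h1, h2, ?_⟩
  rw [h3]
  push_cast
  exact (add_sub_cancel _ _).symm
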